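/- Setting. Let $G=(C,S,E)$ be a bipartite graph with candidates $C=\{c_1,\dots,c_n\}$, positions $S=\{s_1,\dots,s_\ell\}$ and edge set $E\subseteq C\times S$, having at least one matching of cardinality $\ell$; let $\mathcal M$ be the set of all its maximum matchings and, for $e\in E$, let $\mathcal M_e=\{M\in\mathcal M: e\in M\}$. Two edges are comparable if they have the same position. An instance on $G$ is a family of preference probabilities $p_{e,e'}\in[0,1]$ for comparable edges $e,e'$, with $p_{e,e'}=1-p_{e',e}$ (so $p_{e,e}=\tfrac12$). For $M\in\mathcal M$ let $e(M,j)$ be the edge of $M$ at position $s_j$. For an edge $e$ at position $s_j$ put $w(e)=\frac1{|\mathcal M|}\sum_{M\in\mathcal M}p_{e,e(M,j)}$, put $w(M)=\sum_{e\in M}w(e)$, and let $B(M)=\frac1{|\mathcal M|}\sum_{M'\in\mathcal M}\frac1\ell\sum_{j=1}^\ell p_{e(M,j),e(M',j)}=w(M)/\ell$ be the Borda score. If $B$ has a unique maximizer $M^B_*$ on $\mathcal M$, it is called the Borda winner; the Borda gap of $e\in E$ is $\Delta^B_e=w(M^B_*)-\max_{M\in\mathcal M:\,e\in M}w(M)$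 if $e\notin M^B_*$ and $\Delta^B_e=w(M^B_*)-\max_{M\in\mathcal M:\,e\notin M}w(M)$ if $e\in M^B_*$, with $\max\varnothing=-\infty$, and the Borda hardness is $H^B=\sum_{e\in E}(\Delta^B_e)^{-2}$, where an infinite gap contributes $0$. An algorithm knows $G$ but not the preference probabilities; in each round, based on its history and possibly on internal randomness, it either samples a duel $(e,e')$ of comparable edges and observes an independent Bernoulli variable of mean $p_{e,e'}$, or stops and outputs an answer. It is $\delta$-correct if on every instance on $G$ with a unique Borda winner it stops and outputs that winner with probability at least $1-\delta$. Theorem. For every $\gamma\in(0,\tfrac14)$ there is a constant $c>0$, depending only on $\gamma$, such that the following holds. Let $G$ be a graph as above with $\frac{|\mathcal M|}{|\mathcal M|-|\mathcal M_e|}\le\frac{1-4\gamma}{4\gamma\ell}$ for every edge $e\in E$ (only required of edges with $|\mathcal M_e|\neq|\mathcal M|$), and consider an instance on $G$ with a unique Borda winner and with $\tfrac12-\gamma\le p_{e,e'}\le\tfrac12+\gamma$ for all comparable $e,e'\in E$. Then for every $\delta\in(0,0.1)$, every $\delta$-correct algorithm on $G$, run on this instance, has expected number of sampled duels at least $c\,H^B\ln(1/\delta)$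 (the expectation may be infinite). -/

import Mathlib

open scoped ENNReal

noncomputable section

namespace CPEDB

/-- The edges of a bipartite graph with candidates `Fin n`, positions `Fin l` and edge set `E`. -/
abbrev Edge {n l : ℕ} (E : Finset (Fin n × Fin l)) : Type := {e : Fin n × Fin l // e ∈ E}

variable {n l : ℕ} {E : Finset (Fin n × Fin l)}

/-- The candidate of an edge. -/
def Edge.cand (e : Edge E) : Fin n := e.1.1

/-- The position of an edge. -/
def Edge.pos (e : Edge E) : Fin l := e.1.2

/-- A matching: no two distinct edges share a candidate or a position. -/
def IsMatching (M : Finset (Edge E)) : Prop :=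
  ∀ e ∈ M, ∀ e' ∈ M, e ≠ e' → e.cand ≠ e'.cand ∧ e.pos ≠ e'.pos

open Classical in
/-- The decision class: all maximum (cardinality) matchings of the graph. -/
def decisionClass (E : Finset (Fin n × Fin l)) : Finset (Finset (Edge E)) :=
  Finset.univ.filter fun M => IsMatching M ∧ ∀ M' : Finset (Edge E), IsMatching M' → M'.card ≤ M.card

/-- The maximum matchings that contain the edge `e`. -/
def matchingsThrough (e : Edge E) : Finset (Finset (Edge E)) :=
  (decisionClass E).filter fun M => e ∈ M

/-- The maximum matchings that do not contain the edge `e`. -/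
def matchingsAvoiding (e : Edge E) : Finset (Finset (Edge E)) :=
  (decisionClass E).filter fun M => e ∉ M

/-- A preference matrix. For comparable edges (same position), `P.p e e'` is the probability that
`e` wins a duel against `e'`; in particular `P.p e e = 1 / 2`. Entries of incomparable edges
are `0`. -/
structure PreferenceMatrix (E : Finset (Fin n × Fin l)) where
  p : Edge E → Edge E → ℝ
  nonneg : ∀ e e', 0 ≤ p e e'
  le_one : ∀ e e', p e e' ≤ 1
  comparable : ∀ e e', e.pos = e'.pos → p e e' = 1 - p e' e
  incomparable : ∀ e e', e.pos ≠ e'.pos → p e e' = 0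

namespace PreferenceMatrix

variable (P : PreferenceMatrix E)

/-- The preference probability of one matching over another, `χ₁ᵀ P χ₂ / l`. As the entries of
incomparable edges vanish, for matchings of cardinality `l` this is the average over the positions
`j` of the probability that the edge of `M₁` at `j` wins against the edge of `M₂` at `j`. -/
def prefProb (M₁ M₂ : Finset (Edge E)) : ℝ :=
  (1 / (l : ℝ)) * ∑ e ∈ M₁, ∑ e' ∈ M₂, P.p e e'

/-- The Borda score of a matching. -/
def bordaScore (M : Finset (Edge E)) : ℝ :=
  (1 / ((decisionClass E).card : ℝ)) * ∑ M' ∈ decisionClass E, P.prefProb M M'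

/-- `M` is the unique Borda winner. -/
def IsBordaWinner (M : Finset (Edge E)) : Prop :=
  M ∈ decisionClass E ∧ ∀ M' ∈ decisionClass E, M' ≠ M → P.bordaScore M' < P.bordaScore M

/-- The reward of an edge `e`: the probability that `e` wins against the edge at the same position
of a uniformly random maximum matching. The inner sum has at most one nonzero term, the one at
that edge. -/
def reward (e : Edge E) : ℝ :=
  (1 / ((decisionClass E).card : ℝ)) * ∑ M ∈ decisionClass E, ∑ e' ∈ M, P.p e e'

/-- The reward of a matching. -/
def matchingReward (M : Finset (Edge E)) : ℝ := ∑ e ∈ M, P.reward e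

/-- The Borda gap of `e`, where `Mstar` is the Borda winner. The maximum over an empty set of
matchings is `-∞`, and then the gap is `+∞`. -/
def bordaGap (Mstar : Finset (Edge E)) (e : Edge E) : EReal :=
  (P.matchingReward Mstar : EReal) -
    if e ∈ Mstar then (matchingsAvoiding e).sup fun M => (P.matchingReward M : EReal)
    else (matchingsThrough e).sup fun M => (P.matchingReward M : EReal)

/-- The Borda hardness: the sum over all edges of the inverse squared Borda gaps (which are positive
or `+∞`, as `Mstar` is the unique Borda winner); an infinite gap contributes `0`. -/
def bordaHardness (Mstar : Finset (Edge E)) : ℝ≥0∞ :=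
  ∑ e : Edge E, 1 / (P.bordaGap Mstar e).toENNReal ^ 2

end PreferenceMatrix

/-- A duel: an ordered pair of comparable edges. -/
abbrev Duel (E : Finset (Fin n × Fin l)) : Type := {q : Edge E × Edge E // q.1.pos = q.2.pos}

/-- What has been observed so far: the duels played with their outcomes, most recent first;
`true` means that the first edge of the duel won. -/
abbrev History (E : Finset (Fin n × Fin l)) : Type := List (Duel E × Bool)

/-- A (randomized, adaptive) algorithm on a given graph: after each history it draws at random
either a next duel to sample or a set of edges to stop with and answer. It does not see the
preference matrix. -/
abbrev Algorithm (E : Finset (Fin n × Fin l)) : Type :=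
  History E → PMF (Duel E ⊕ Finset (Edge E))

/-- The law of the outcome of a duel: the first edge wins with its preference probability. -/
def PreferenceMatrix.outcome (P : PreferenceMatrix E) (q : Duel E) : PMF Bool :=
  PMF.ofFintype
    (fun b => if b then ENNReal.ofReal (P.p q.1.1 q.1.2) else ENNReal.ofReal (1 - P.p q.1.1 q.1.2))
    (by
      rw [Fintype.sum_bool]
      simp only [if_true, Bool.false_eq_true, if_false]
      rw [← ENNReal.ofReal_add (P.nonneg _ _) (sub_nonneg.mpr (P.le_one _ _))]
      simp)

/-- The state of a run: the history, and the answer once the algorithm has stopped. -/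
abbrev RunState (E : Finset (Fin n × Fin l)) : Type := History E × Option (Finset (Edge E))

namespace Algorithm

variable (A : Algorithm E) (P : PreferenceMatrix E)

/-- One step of a run: a stopped run stays as it is; otherwise the algorithm either stops with an
answer, or samples a duel, whose random outcome is added to the history. -/
def step : RunState E → PMF (RunState E)
  | (h, some M) => PMF.pure (h, some M)
  | (h, none) => (A h).bind fun a =>
      match a with
      | Sum.inl q => (P.outcome q).map fun b => ((q, b) :: h, none)
      | Sum.inr M => PMF.pure (h, some M)

/-- The law of the state after `t` steps. -/
def run : ℕ → PMF (RunState E)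
  | 0 => PMF.pure ([], none)
  | t + 1 => (run t).bind (step A P)

/-- The probability that the algorithm stops and answers `M` (the supremum over `t` of the
probabilities that it has done so within `t` steps). -/
def answerProb (M : Finset (Edge E)) : ℝ≥0∞ :=
  ⨆ t : ℕ, ((run A P t).map Prod.snd) (some M)

/-- The expected total number of sampled duels (the supremum over `t` of the expected number of
duels sampled within the first `t` steps; `∞` if the algorithm fails to stop with positive
probability). -/
def expectedSamples : ℝ≥0∞ :=
  ⨆ t : ℕ, ∑' s : RunState E, (run A P t s) * (s.1.length : ℝ≥0∞)

/-- The algorithm is `δ`-correct: on every instance that has a unique Borda winner, it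
identifies this winner with probability at least `1 - δ`. -/
def IsCorrect (δ : ℝ) : Prop :=
  ∀ (P : PreferenceMatrix E) (M : Finset (Edge E)), P.IsBordaWinner M →
    ENNReal.ofReal (1 - δ) ≤ answerProb A P M

end Algorithm

end CPEDB

end

/-! The proof is a change-of-measure argument, one edge at a time. Let `e` have finite gap `Δ`, and
let `M` be the best maximum matching that disagrees with the winner `Mstar` about `e`. Shifting each
preference of `f` over `f'` by `a f - a f'` changes the reward of a maximum matching by the sum of
`a` over it, up to a constant common to all of them (`matchingReward_perturb`). A potential of `Δ`
or `-Δ` at `e` therefore closes the gap between `M` and `Mstar`, and a small `η > 0` on the edges of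
`M` makes `M` the unique winner (`isBordaWinner_perturb_promote`).

The hypotheses force `Δ ≤ 1/2 - 2γ` (`IsBestDisagreeing.gap_le`), so the shifted probabilities stay
in `[γ/2, 1 - γ/2]`. A duel then has divergence at most `8Δ²/γ` if it involves `e`, plus `8η²/γ` in
any case.

A δ-correct algorithm answers `Mstar` with probability at most `δ` on the shifted instance. By
`answer_mul_log_le` and `η → 0`, the expected number of duels involving `e` is at least of order `γ
ln(1/δ) / Δ²`. Summing over `e` gives the hardness, since a duel involves at most two edges.
Everything happens at a fixed time by which `Mstar` has been answered with probability at least 4/5,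
so all expectations are finite sums. -/

namespace CPEDB

/-! ### Expectations under finitely supported laws. -/

section Expectation

variable {α β : Type*}

/-- The expectation of a real function under a probability mass function (used for those of finite
support). -/
noncomputable def expect (p : PMF α) (f : α → ℝ) : ℝ := ∑' a, (p a).toReal * f a

theorem expect_eq_sum {p : PMF α} (f : α → ℝ) {s : Finset α} (hs : ∀ a, p a ≠ 0 → a ∈ s) :
    expect p f = ∑ a ∈ s, (p a).toReal * f a := by
  refine tsum_eq_sum fun a ha => ?_
  have : p a = 0 := by
    by_contra h
    exact ha (hs a h)
  simp [this]

theorem expect_eq_sum_support {p : PMF α} (hp : p.support.Finite) (f : α → ℝ) :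
    expect p f = ∑ a ∈ hp.toFinset, (p a).toReal * f a :=
  expect_eq_sum f fun a ha => by simpa using ha

theorem expect_pure (a : α) (f : α → ℝ) : expect (PMF.pure a) f = f a := by
  rw [expect_eq_sum f (s := {a}) (by intro b hb; by_contra h; simp_all [PMF.pure_apply])]
  simp [PMF.pure_apply]

theorem expect_bind {p : PMF α} {q : α → PMF β} (hp : p.support.Finite)
    (hq : ∀ a, (q a).support.Finite) (f : β → ℝ) :
    expect (p.bind q) f = expect p fun a => expect (q a) f := by
  classical
  set S := hp.toFinset
  set T := S.biUnion fun a => (hq a).toFinset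
  have hT : ∀ b, p.bind q b ≠ 0 → b ∈ T := by
    intro b hb
    have : b ∈ (p.bind q).support := hb
    rw [PMF.mem_support_bind_iff] at this
    obtain ⟨a, ha, hab⟩ := this
    simp only [T, S, Finset.mem_biUnion, Set.Finite.mem_toFinset]
    exact ⟨a, ha, hab⟩
  rw [expect_eq_sum f hT, expect_eq_sum_support hp]
  have h1 : ∀ a ∈ S, expect (q a) f = ∑ b ∈ T, (q a b).toReal * f b := by
    intro a ha
    refine expect_eq_sum f fun b hb => ?_
    simp only [T, Finset.mem_biUnion, Set.Finite.mem_toFinset]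
    exact ⟨a, ha, hb⟩
  have h2 : ∀ b, (p.bind q b).toReal = ∑ a ∈ S, (p a).toReal * (q a b).toReal := by
    intro b
    rw [PMF.bind_apply, tsum_eq_sum (s := S), ENNReal.toReal_sum]
    · simp [ENNReal.toReal_mul]
    · intro a _
      exact ENNReal.mul_ne_top (p.apply_ne_top a) ((q a).apply_ne_top b)
    · intro a ha
      have : p a = 0 := by
        by_contra h
        exact ha (by simpa [S] using h)
      simp [this]
  calc ∑ b ∈ T, (p.bind q b).toReal * f b
      = ∑ b ∈ T, ∑ a ∈ S, (p a).toReal * ((q a b).toReal * f b) := by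
        simp_rw [h2, Finset.sum_mul, mul_assoc]
    _ = ∑ a ∈ S, (p a).toReal * expect (q a) f := by
        rw [Finset.sum_comm]
        exact Finset.sum_congr rfl fun a ha => by rw [h1 a ha, Finset.mul_sum]

theorem expect_map {p : PMF α} (hp : p.support.Finite) (g : α → β) (f : β → ℝ) :
    expect (p.map g) f = expect p (f ∘ g) := by
  rw [← PMF.bind_pure_comp, expect_bind hp]
  · simp [expect_pure, Function.comp_def]
  · intro a
    simp [PMF.support_pure]

theorem expect_mono {p : PMF α} (hp : p.support.Finite) {f g : α → ℝ} (h : ∀ a, f a ≤ g a) :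
    expect p f ≤ expect p g := by
  rw [expect_eq_sum_support hp, expect_eq_sum_support hp]
  exact Finset.sum_le_sum fun a _ => mul_le_mul_of_nonneg_left (h a) ENNReal.toReal_nonneg

theorem expect_add {p : PMF α} (hp : p.support.Finite) (f g : α → ℝ) :
    expect p (fun a => f a + g a) = expect p f + expect p g := by
  simp_rw [expect_eq_sum_support hp, mul_add, Finset.sum_add_distrib]

theorem expect_const_mul (p : PMF α) (c : ℝ) (f : α → ℝ) :
    expect p (fun a => c * f a) = c * expect p f := by
  unfold expect
  rw [← tsum_mul_left]
  exact tsum_congr fun a => by ring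

theorem expect_const (p : PMF α) (c : ℝ) : expect p (fun _ => c) = c := by
  unfold expect
  rw [tsum_mul_right, ← ENNReal.tsum_toReal_eq p.apply_ne_top, p.tsum_coe]
  simp

theorem expect_finset_sum {p : PMF α} (hp : p.support.Finite) {ι : Type*} (s : Finset ι)
    (f : ι → α → ℝ) :
    expect p (fun a => ∑ i ∈ s, f i a) = ∑ i ∈ s, expect p (f i) := by
  simp_rw [expect_eq_sum_support hp, Finset.mul_sum]
  rw [Finset.sum_comm]

theorem ofReal_expect {p : PMF α} (hp : p.support.Finite) {f : α → ℝ} (hf : ∀ a, 0 ≤ f a) :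
    ENNReal.ofReal (expect p f) = ∑' a, p a * ENNReal.ofReal (f a) := by
  rw [expect_eq_sum_support hp, ENNReal.ofReal_sum_of_nonneg
    fun a _ => mul_nonneg ENNReal.toReal_nonneg (hf a), tsum_eq_sum (s := hp.toFinset)]
  · refine Finset.sum_congr rfl fun a _ => ?_
    rw [ENNReal.ofReal_mul ENNReal.toReal_nonneg, ENNReal.ofReal_toReal (p.apply_ne_top a)]
  · intro a ha
    have : p a = 0 := by
      by_contra h
      exact ha (by simpa using h)
    simp [this]

theorem toReal_map_apply [DecidableEq β] {p : PMF α} (hp : p.support.Finite) (g : α → β) (b : β) :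
    (p.map g b).toReal = expect p fun a => if g a = b then 1 else 0 := by
  have h : p.map g b = ENNReal.ofReal (expect p fun a => if g a = b then 1 else 0) := by
    rw [ofReal_expect hp (fun a => by split_ifs <;> simp), PMF.map_apply]
    refine tsum_congr fun a => ?_
    by_cases hab : g a = b
    · simp [hab]
    · simp [hab, Ne.symm hab]
  rw [h, ENNReal.toReal_ofReal]
  rw [expect_eq_sum_support hp]
  exact Finset.sum_nonneg fun a _ => mul_nonneg ENNReal.toReal_nonneg (by split_ifs <;> simp)

end Expectation

variable {n l : ℕ} {E : Finset (Fin n × Fin l)}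

/-! ### Likelihood ratios and change of measure for runs. -/

/-- The probability of the outcome `b` of the duel `q`, as a real number. -/
def PreferenceMatrix.outcomeProb (P : PreferenceMatrix E) (q : Duel E) (b : Bool) : ℝ :=
  if b then P.p q.1.1 q.1.2 else 1 - P.p q.1.1 q.1.2

theorem PreferenceMatrix.outcome_apply (P : PreferenceMatrix E) (q : Duel E) (b : Bool) :
    P.outcome q b = ENNReal.ofReal (P.outcomeProb q b) := by
  cases b <;> simp [PreferenceMatrix.outcome, PreferenceMatrix.outcomeProb]

theorem PreferenceMatrix.outcomeProb_nonneg (P : PreferenceMatrix E) (q : Duel E) (b : Bool) :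
    0 ≤ P.outcomeProb q b := by
  cases b
  · simpa [PreferenceMatrix.outcomeProb] using P.le_one _ _
  · simpa [PreferenceMatrix.outcomeProb] using P.nonneg _ _

theorem PreferenceMatrix.expect_outcome (P : PreferenceMatrix E) (q : Duel E) (f : Bool → ℝ) :
    expect (P.outcome q) f = P.outcomeProb q true * f true + P.outcomeProb q false * f false := by
  rw [expect_eq_sum f (s := Finset.univ) (by simp), Fintype.sum_bool]
  simp [P.outcome_apply, P.outcomeProb_nonneg]

/-- The likelihood ratio of a history under `Q` relative to `P`. -/
noncomputable def likelihoodRatio (P Q : PreferenceMatrix E) (h : History E) : ℝ :=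
  (h.map fun x => Q.outcomeProb x.1 x.2 / P.outcomeProb x.1 x.2).prod

theorem likelihoodRatio_pos {P Q : PreferenceMatrix E} (hP : ∀ q b, 0 < P.outcomeProb q b)
    (hQ : ∀ q b, 0 < Q.outcomeProb q b) (h : History E) : 0 < likelihoodRatio P Q h := by
  refine List.prod_pos fun x hx => ?_
  obtain ⟨y, _, rfl⟩ := List.mem_map.1 hx
  exact div_pos (hQ _ _) (hP _ _)

namespace Algorithm

variable (A : Algorithm E) (P Q : PreferenceMatrix E)

theorem support_outcome_map_finite (q : Duel E) {β : Type*} (g : Bool → β) :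
    ((P.outcome q).map g).support.Finite := by
  rw [PMF.support_map]
  exact (Set.toFinite _).image _

theorem support_step_finite (s : RunState E) : (step A P s).support.Finite := by
  obtain ⟨h, _ | M⟩ := s
  · rw [step, PMF.support_bind]
    refine Set.Finite.biUnion (Set.toFinite _) fun a _ => ?_
    rcases a with q | M
    · exact support_outcome_map_finite P q _
    · simp [PMF.support_pure]
  · simp [step, PMF.support_pure]

theorem support_run_finite (t : ℕ) : (run A P t).support.Finite := by
  induction t with
  | zero => simp [run, PMF.support_pure]
  | succ t ih =>
    rw [run, PMF.support_bind]
    exact Set.Finite.biUnion ih fun s _ => support_step_finite A P s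

theorem expect_run_succ (t : ℕ) (f : RunState E → ℝ) :
    expect (run A P (t + 1)) f = expect (run A P t) fun s => expect (step A P s) f :=
  expect_bind (support_run_finite A P t) (support_step_finite A P) f

/-- The one-step submartingale inequality. Conditions are needed only at running states, because
stopped states are absorbing. -/
theorem le_expect_step {f : RunState E → ℝ}
    (hanswer : ∀ h M, f (h, none) ≤ f (h, some M))
    (hduel : ∀ h (q : Duel E), f (h, none) ≤
      P.outcomeProb q true * f ((q, true) :: h, none) +
        P.outcomeProb q false * f ((q, false) :: h, none)) (s : RunState E) :
    f s ≤ expect (step A P s) f := by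
  obtain ⟨h, _ | M⟩ := s
  · rw [step, expect_bind (Set.toFinite _)]
    · rw [← expect_const (A h) (f (h, none))]
      refine expect_mono (Set.toFinite _) fun a => ?_
      rcases a with q | M
      · simp only
        rw [expect_map (Set.toFinite _), P.expect_outcome]
        exact hduel h q
      · simp only [expect_pure]
        exact hanswer h M
    · intro a
      rcases a with q | M
      · exact support_outcome_map_finite P q _
      · simp [PMF.support_pure]
  · rw [step, expect_pure]

theorem le_expect_run {f : RunState E → ℝ}
    (hanswer : ∀ h M, f (h, none) ≤ f (h, some M))
    (hduel : ∀ h (q : Duel E), f (h, none) ≤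
      P.outcomeProb q true * f ((q, true) :: h, none) +
        P.outcomeProb q false * f ((q, false) :: h, none)) (t : ℕ) :
    f ([], none) ≤ expect (run A P t) f := by
  induction t with
  | zero => rw [run, expect_pure]
  | succ t ih =>
    rw [expect_run_succ]
    exact ih.trans (expect_mono (support_run_finite A P t) (le_expect_step A P hanswer hduel))

theorem likelihoodRatio_mul_pure (r s : RunState E) :
    ENNReal.ofReal (likelihoodRatio P Q r.1) * PMF.pure r s =
      PMF.pure r s * ENNReal.ofReal (likelihoodRatio P Q s.1) := by
  classical
  by_cases h : s = r
  · subst h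
    rw [mul_comm]
  · simp [PMF.pure_apply, h]

variable {P Q}

/-- The algorithm draws its next action in the same way on both instances, so its randomness
cancels. Only the outcome of a duel contributes a factor, which is the one the ratio gains. -/
theorem likelihoodRatio_mul_step (hP : ∀ q b, 0 < P.outcomeProb q b) (r s : RunState E) :
    ENNReal.ofReal (likelihoodRatio P Q r.1) * step A Q r s =
      step A P r s * ENNReal.ofReal (likelihoodRatio P Q s.1) := by
  classical
  obtain ⟨h, _ | M⟩ := r
  · simp only [step, PMF.bind_apply]
    rw [← ENNReal.tsum_mul_left, ← ENNReal.tsum_mul_right]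
    refine tsum_congr fun a => ?_
    rcases a with q | M
    · simp only [PMF.map_apply]
      rw [mul_left_comm, mul_assoc, ← ENNReal.tsum_mul_left, ← ENNReal.tsum_mul_right]
      congr 1
      refine tsum_congr fun b => ?_
      by_cases hs : s = ((q, b) :: h, none)
      · subst hs
        simp only [if_true]
        rw [P.outcome_apply, Q.outcome_apply, ← ENNReal.ofReal_mul' (Q.outcomeProb_nonneg q b),
          ← ENNReal.ofReal_mul (P.outcomeProb_nonneg q b)]
        congr 1
        simp only [likelihoodRatio, List.map_cons, List.prod_cons]
        have := (hP q b).ne'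
        field_simp
      · simp [hs]
    · have := likelihoodRatio_mul_pure P Q (h, some M) s
      simp only at this ⊢
      rw [mul_left_comm, this, mul_assoc]
  · exact likelihoodRatio_mul_pure P Q (h, some M) s

theorem run_eq_run_mul_likelihoodRatio (hP : ∀ q b, 0 < P.outcomeProb q b) (t : ℕ)
    (s : RunState E) :
    run A Q t s = run A P t s * ENNReal.ofReal (likelihoodRatio P Q s.1) := by
  induction t generalizing s with
  | zero =>
    rw [run, run, ← likelihoodRatio_mul_pure]
    simp [likelihoodRatio]
  | succ t ih =>
    simp only [run, PMF.bind_apply]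
    rw [← ENNReal.tsum_mul_right]
    refine tsum_congr fun r => ?_
    rw [ih, mul_assoc, likelihoodRatio_mul_step A hP, mul_assoc]

theorem expect_run_change (hP : ∀ q b, 0 < P.outcomeProb q b)
    (hQ : ∀ q b, 0 < Q.outcomeProb q b) (t : ℕ) (f : RunState E → ℝ) :
    expect (run A Q t) f = expect (run A P t) fun s => likelihoodRatio P Q s.1 * f s := by
  refine tsum_congr fun s => ?_
  rw [run_eq_run_mul_likelihoodRatio A hP, ENNReal.toReal_mul,
    ENNReal.toReal_ofReal (likelihoodRatio_pos hP hQ _).le, mul_assoc]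

/-- The expected log-likelihood ratio of `P` relative to `Q` is at most the expected sum of the Kullback–Leibler
divergences of the sampled duels, here bounded by `κ`. -/
theorem expect_neg_log_likelihoodRatio_le (hP : ∀ q b, 0 < P.outcomeProb q b)
    (hQ : ∀ q b, 0 < Q.outcomeProb q b) {κ : Duel E → ℝ}
    (hκ : ∀ q, P.outcomeProb q true * Real.log (P.outcomeProb q true / Q.outcomeProb q true) +
      P.outcomeProb q false * Real.log (P.outcomeProb q false / Q.outcomeProb q false) ≤ κ q)
    (t : ℕ) :
    0 ≤ expect (run A P t) fun s =>
      Real.log (likelihoodRatio P Q s.1) + (s.1.map fun x => κ x.1).sum := by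
  have h := le_expect_run A P (f := fun s =>
    Real.log (likelihoodRatio P Q s.1) + (s.1.map fun x => κ x.1).sum) (fun _ _ => le_rfl) ?_ t
  · simpa [likelihoodRatio] using h
  intro h q
  have hL : ∀ b, Real.log (likelihoodRatio P Q ((q, b) :: h)) =
      - Real.log (P.outcomeProb q b / Q.outcomeProb q b) + Real.log (likelihoodRatio P Q h) := by
    intro b
    have : likelihoodRatio P Q ((q, b) :: h) =
        Q.outcomeProb q b / P.outcomeProb q b * likelihoodRatio P Q h := by
      simp [likelihoodRatio]
    rw [this, Real.log_mul (div_pos (hQ _ _) (hP _ _)).ne' (likelihoodRatio_pos hP hQ h).ne',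
      ← Real.log_inv, inv_div]
  simp only [hL, List.map_cons, List.sum_cons]
  have hsum : P.outcomeProb q false = 1 - P.outcomeProb q true := by
    simp [PreferenceMatrix.outcomeProb]
  have := hκ q
  rw [hsum] at *
  nlinarith

/-- The change-of-measure inequality. -/
theorem answer_mul_log_le (hP : ∀ q b, 0 < P.outcomeProb q b)
    (hQ : ∀ q b, 0 < Q.outcomeProb q b) {κ : Duel E → ℝ}
    (hκ : ∀ q, P.outcomeProb q true * Real.log (P.outcomeProb q true / Q.outcomeProb q true) +
      P.outcomeProb q false * Real.log (P.outcomeProb q false / Q.outcomeProb q false) ≤ κ q)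
    (t : ℕ) (M : Finset (Edge E)) {δ : ℝ} (hδ : 0 < δ)
    (hM : ((run A Q t).map Prod.snd (some M)).toReal ≤ δ) :
    ((run A P t).map Prod.snd (some M)).toReal * Real.log (1 / δ) - 1 ≤
      expect (run A P t) fun s => (s.1.map fun x => κ x.1).sum := by
  have hfin := support_run_finite A P t
  have h0 := expect_neg_log_likelihoodRatio_le A hP hQ hκ t
  rw [expect_add hfin] at h0
  rw [toReal_map_apply (support_run_finite A Q t), expect_run_change A hP hQ] at hM
  have h1 := expect_run_change A hP hQ t (fun _ => 1)
  rw [expect_const] at h1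
  rw [toReal_map_apply hfin]
  -- The bound `log x ≤ x - 1` is used at `x = ratio / δ` where `M` is answered and at `x = ratio`
  -- elsewhere. In expectation under `P` the ratio turns into probabilities under `Q`: the first
  -- term is at most 1 by `hM`, and the second equals 1.
  have h2 : expect (run A P t) (fun s => Real.log (likelihoodRatio P Q s.1)) ≤
      expect (run A P t) (fun s => 1 / δ * (likelihoodRatio P Q s.1 *
        (if s.2 = some M then 1 else 0)) + (likelihoodRatio P Q s.1 * 1 +
        (-1 + Real.log δ * if s.2 = some M then 1 else 0))) := by
    refine expect_mono hfin fun s => ?_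
    have hL := likelihoodRatio_pos hP hQ s.1
    split_ifs with hs
    · have := Real.log_le_sub_one_of_pos (div_pos hL hδ)
      rw [Real.log_div hL.ne' hδ.ne'] at this
      have e : 1 / δ * (likelihoodRatio P Q s.1 * 1) = likelihoodRatio P Q s.1 / δ := by ring
      rw [e]
      linarith
    · have := Real.log_le_sub_one_of_pos hL
      linarith
  rw [expect_add hfin, expect_add hfin, expect_add hfin, expect_const_mul, expect_const_mul,
    expect_const, ← h1] at h2
  have h3 : 1 / δ * expect (run A P t) (fun s => likelihoodRatio P Q s.1 *
      (if s.2 = some M then 1 else 0)) ≤ 1 := by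
    rw [div_mul_eq_mul_div, one_mul]
    exact div_le_one_of_le₀ hM hδ.le
  rw [one_div, Real.log_inv]
  linarith

variable (P)

theorem map_snd_run_mono (M : Finset (Edge E)) :
    Monotone fun t => (run A P t).map Prod.snd (some M) := by
  refine monotone_nat_of_le_succ fun t => ?_
  rw [← ENNReal.toReal_le_toReal (PMF.apply_ne_top _ _) (PMF.apply_ne_top _ _),
    toReal_map_apply (support_run_finite A P t), toReal_map_apply (support_run_finite A P (t + 1)),
    expect_run_succ]
  refine expect_mono (support_run_finite A P t) fun s => ?_
  obtain ⟨h, _ | M'⟩ := s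
  · simp only [reduceCtorEq, if_false]
    refine (expect_const (step A P (h, none)) 0).ge.trans ?_
    exact expect_mono (support_step_finite A P _) fun s => by split_ifs <;> norm_num
  · rw [step, expect_pure]

/-- Different answers are disjoint events, and answer probabilities only grow with time, so both can
be compared at a common later time. -/
theorem map_snd_run_le_of_answerProb {M M' : Finset (Edge E)} (hne : M' ≠ M) {δ : ℝ}
    (hM : ENNReal.ofReal (1 - δ) ≤ answerProb A P M) (t : ℕ) :
    ((run A P t).map Prod.snd (some M')).toReal ≤ δ := by
  set x := (run A P t).map Prod.snd (some M') with hx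
  have hx1 : x ≤ 1 := PMF.coe_le_one _ _
  have hsup : answerProb A P M ≤ 1 - x := by
    refine iSup_le fun t' => ?_
    have h1 := map_snd_run_mono A P M (le_max_right t t')
    have h2 := map_snd_run_mono A P M' (le_max_left t t')
    refine ENNReal.le_sub_of_add_le_right (PMF.apply_ne_top _ _) ?_
    refine (add_le_add h1 h2).trans ?_
    rw [← ((run A P (max t t')).map Prod.snd).tsum_coe]
    have := ENNReal.sum_le_tsum (f := (run A P (max t t')).map Prod.snd) {some M, some M'}
    rwa [Finset.sum_pair (by simpa using hne.symm)] at this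
  have h := ENNReal.toReal_mono (by finiteness) (hM.trans hsup)
  rw [ENNReal.toReal_sub_of_le hx1 (by simp)] at h
  have h' : 1 - δ ≤ (ENNReal.ofReal (1 - δ)).toReal := by
    rw [ENNReal.toReal_ofReal']
    exact le_max_left _ _
  simp only [ENNReal.toReal_one] at h
  linarith

end Algorithm

end CPEDB

/-! ### Maximum matchings, rewards and the alternative instances. -/

namespace CPEDB

variable {n l : ℕ} {E : Finset (Fin n × Fin l)}

theorem IsMatching.injOn_pos {M : Finset (Edge E)} (hM : IsMatching M) :
    Set.InjOn Edge.pos (M : Set (Edge E)) := by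
  intro e he e' he' h
  by_contra hne
  exact (hM e he e' he' hne).2 h

theorem IsMatching.card_le {M : Finset (Edge E)} (hM : IsMatching M) : M.card ≤ l := by
  rw [← Finset.card_image_of_injOn hM.injOn_pos]
  simpa using Finset.card_le_univ (M.image Edge.pos)

section

variable (hl : ∃ M : Finset (Edge E), IsMatching M ∧ M.card = l)
include hl

theorem decisionClass_nonempty : (decisionClass E).Nonempty := by
  obtain ⟨M, hM, hc⟩ := hl
  exact ⟨M, by simpa [decisionClass, hM, hc] using fun M' hM' => IsMatching.card_le hM'⟩

/-- Positions are distinct along a matching, so `l` bounds its cardinality, and `hl` says that the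
bound is attained. Maximum matchings thus meet every position exactly once. -/
theorem isMatching_and_card_of_mem {M : Finset (Edge E)} (hM : M ∈ decisionClass E) :
    IsMatching M ∧ M.card = l := by
  simp only [decisionClass, Finset.mem_filter, Finset.mem_univ, true_and] at hM
  obtain ⟨M', hM', hc⟩ := hl
  exact ⟨hM.1, le_antisymm hM.1.card_le (hc.ge.trans (hM.2 M' hM'))⟩

theorem image_pos_eq_univ {M : Finset (Edge E)} (hM : M ∈ decisionClass E) :
    M.image Edge.pos = Finset.univ := by
  obtain ⟨h, hc⟩ := isMatching_and_card_of_mem hl hM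
  apply Finset.eq_univ_of_card
  rw [Finset.card_image_of_injOn h.injOn_pos, hc, Fintype.card_fin]

theorem sum_comp_pos {M : Finset (Edge E)} (hM : M ∈ decisionClass E) (f : Fin l → ℝ) :
    ∑ e ∈ M, f e.pos = ∑ j, f j := by
  rw [← image_pos_eq_univ hl hM,
    Finset.sum_image (isMatching_and_card_of_mem hl hM).1.injOn_pos]

theorem exists_mem_pos_eq {M : Finset (Edge E)} (hM : M ∈ decisionClass E) (j : Fin l) :
    ∃ e ∈ M, e.pos = j := by
  have : j ∈ M.image Edge.pos := by simp [image_pos_eq_univ hl hM]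
  simpa using this

namespace PreferenceMatrix

variable (P : PreferenceMatrix E)

theorem exists_sum_p_eq {M : Finset (Edge E)} (hM : M ∈ decisionClass E) (e : Edge E) :
    ∃ e' : Edge E, e.pos = e'.pos ∧ ∑ f ∈ M, P.p e f = P.p e e' := by
  obtain ⟨e', he', hpos⟩ := exists_mem_pos_eq hl hM e.pos
  refine ⟨e', hpos.symm, Finset.sum_eq_single_of_mem e' he' fun f hf hne => ?_⟩
  refine P.incomparable _ _ fun h => hne ?_
  exact (isMatching_and_card_of_mem hl hM).1.injOn_pos hf he' (h.symm.trans hpos.symm)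

theorem reward_bounds {r s : ℝ} (hp : ∀ e e' : Edge E, e.pos = e'.pos → r ≤ P.p e e' ∧ P.p e e' ≤ s)
    (e : Edge E) : r ≤ P.reward e ∧ P.reward e ≤ s := by
  have hN : (0 : ℝ) < (decisionClass E).card := by
    exact_mod_cast (decisionClass_nonempty hl).card_pos
  have h : ∀ M ∈ decisionClass E, r ≤ ∑ f ∈ M, P.p e f ∧ ∑ f ∈ M, P.p e f ≤ s := by
    intro M hM
    obtain ⟨e', hpos, h⟩ := P.exists_sum_p_eq hl hM e
    rw [h]
    exact hp e e' hpos
  rw [reward, one_div_mul_eq_div, le_div_iff₀ hN, div_le_iff₀ hN]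
  have h1 := Finset.card_nsmul_le_sum _ _ _ fun M hM => (h M hM).1
  have h2 := Finset.sum_le_card_nsmul _ _ _ fun M hM => (h M hM).2
  rw [nsmul_eq_mul] at h1 h2
  constructor <;> linarith

theorem matchingReward_bounds {r s : ℝ}
    (hp : ∀ e e' : Edge E, e.pos = e'.pos → r ≤ P.p e e' ∧ P.p e e' ≤ s)
    {M : Finset (Edge E)} (hM : M ∈ decisionClass E) :
    l * r ≤ P.matchingReward M ∧ P.matchingReward M ≤ l * s := by
  have h1 := Finset.card_nsmul_le_sum M P.reward r fun e _ => (P.reward_bounds hl hp e).1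
  have h2 := Finset.sum_le_card_nsmul M P.reward s fun e _ => (P.reward_bounds hl hp e).2
  rw [nsmul_eq_mul, (isMatching_and_card_of_mem hl hM).2] at h1 h2
  exact ⟨h1, h2⟩

end PreferenceMatrix

end

namespace PreferenceMatrix

variable (P : PreferenceMatrix E)

theorem bordaScore_eq (M : Finset (Edge E)) :
    P.bordaScore M = 1 / (l : ℝ) * P.matchingReward M := by
  simp only [bordaScore, prefProb, matchingReward, reward]
  rw [← Finset.mul_sum, ← Finset.mul_sum, mul_left_comm, Finset.sum_comm]

theorem isBordaWinner_iff (hl : 0 < l) (M : Finset (Edge E)) :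
    P.IsBordaWinner M ↔ M ∈ decisionClass E ∧
      ∀ M' ∈ decisionClass E, M' ≠ M → P.matchingReward M' < P.matchingReward M := by
  have h : 0 < 1 / (l : ℝ) := by positivity
  simp only [IsBordaWinner, bordaScore_eq, mul_lt_mul_iff_right₀ h]

/-- Shift the strength of every edge by a potential `a`. -/
def perturb (a : Edge E → ℝ) (h : ∀ e e' : Edge E, e.pos = e'.pos → 0 ≤ P.p e e' + (a e - a e')) :
    PreferenceMatrix E where
  p e e' := if e.pos = e'.pos then P.p e e' + (a e - a e') else 0
  nonneg e e' := by
    split_ifs with hpos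
    · exact h e e' hpos
    · exact le_rfl
  le_one e e' := by
    split_ifs with hpos
    · have := h e' e hpos.symm
      rw [P.comparable e e' hpos]
      linarith
    · exact zero_le_one
  comparable e e' hpos := by
    rw [if_pos hpos, if_pos hpos.symm, P.comparable e e' hpos]
    ring
  incomparable e e' hpos := if_neg hpos

variable {a : Edge E → ℝ} {h : ∀ e e' : Edge E, e.pos = e'.pos → 0 ≤ P.p e e' + (a e - a e')}

/-- The reward of `e` gains `a e` and loses the mean potential at its position. As `M` meets each
position once, these losses add up to the mean total potential of a maximum matching, whatever `M`
is. -/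
theorem matchingReward_perturb (hl : ∃ M : Finset (Edge E), IsMatching M ∧ M.card = l)
    {M : Finset (Edge E)} (hM : M ∈ decisionClass E) :
    (P.perturb a h).matchingReward M = P.matchingReward M + ∑ e ∈ M, a e -
      1 / ((decisionClass E).card : ℝ) * ∑ M' ∈ decisionClass E, ∑ e ∈ M', a e := by
  have hN : ((decisionClass E).card : ℝ) ≠ 0 := by
    exact_mod_cast (decisionClass_nonempty hl).card_pos.ne'
  -- For a maximum matching `M'`, this is the potential of its edge at position `j`.
  set T : Finset (Edge E) → Fin l → ℝ := fun M' j => ∑ e' ∈ M', if j = e'.pos then a e' else 0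
  have hT : ∀ M', ∑ j, T M' j = ∑ e ∈ M', a e := by
    intro M'
    rw [Finset.sum_comm]
    simp
  have hsum : ∀ M' ∈ decisionClass E, ∀ e, ∑ e' ∈ M', (P.perturb a h).p e e' =
      ∑ e' ∈ M', P.p e e' + a e - T M' e.pos := by
    intro M' hM' e
    have h1 : ∑ e' ∈ M', (if e.pos = e'.pos then a e else 0) = a e := by
      rw [sum_comp_pos hl hM' fun j => if e.pos = j then a e else 0]
      simp
    conv_rhs => rw [← h1]
    rw [← Finset.sum_add_distrib, ← Finset.sum_sub_distrib]
    refine Finset.sum_congr rfl fun e' _ => ?_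
    by_cases hpos : e.pos = e'.pos
    · simp only [perturb, hpos, if_true]
      ring
    · simp [perturb, hpos, P.incomparable _ _ hpos]
  have hreward : ∀ e, (P.perturb a h).reward e = P.reward e + a e -
      1 / ((decisionClass E).card : ℝ) * ∑ M' ∈ decisionClass E, T M' e.pos := by
    intro e
    simp only [reward]
    rw [Finset.sum_congr rfl fun M' hM' => hsum M' hM' e, Finset.sum_sub_distrib,
      Finset.sum_add_distrib, Finset.sum_const, nsmul_eq_mul]
    field_simp
  simp only [matchingReward, hreward]
  rw [Finset.sum_sub_distrib, Finset.sum_add_distrib, ← Finset.mul_sum, Finset.sum_comm]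
  congr 2
  refine Finset.sum_congr rfl fun M' _ => ?_
  rw [sum_comp_pos hl hM, hT]

end PreferenceMatrix

/-- `M` is a matching of maximal reward among those that disagree with `Mstar` about `e`. -/
def IsBestDisagreeing (P : PreferenceMatrix E) (Mstar : Finset (Edge E)) (e : Edge E)
    (M : Finset (Edge E)) : Prop :=
  M ∈ decisionClass E ∧ (e ∈ M ↔ e ∉ Mstar) ∧
    ∀ M' ∈ decisionClass E, (e ∈ M' ↔ e ∉ Mstar) → P.matchingReward M' ≤ P.matchingReward M

theorem eq_empty_or_exists_sup_coe_eq (S : Finset (Finset (Edge E))) (w : Finset (Edge E) → ℝ) :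
    S = ∅ ∨ ∃ M ∈ S, (∀ M' ∈ S, w M' ≤ w M) ∧ S.sup (fun M => (w M : EReal)) = (w M : EReal) := by
  rcases S.eq_empty_or_nonempty with hS | hS
  · exact Or.inl hS
  · obtain ⟨M, hM, hmax⟩ := S.exists_max_image w hS
    refine Or.inr ⟨M, hM, hmax, le_antisymm ?_ ?_⟩
    · exact Finset.sup_le fun M' hM' => EReal.coe_le_coe_iff.2 (hmax M' hM')
    · exact Finset.le_sup (f := fun M => (w M : EReal)) hM

/-- An edge contributes to the Borda hardness only through a best disagreeing matching. -/
theorem bordaGap_cases (P : PreferenceMatrix E) (Mstar : Finset (Edge E)) (e : Edge E) :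
    1 / (P.bordaGap Mstar e).toENNReal ^ 2 = 0 ∨
      ∃ M, IsBestDisagreeing P Mstar e M ∧ (P.bordaGap Mstar e).toENNReal =
        ENNReal.ofReal (P.matchingReward Mstar - P.matchingReward M) := by
  have key : ∀ S : Finset (Finset (Edge E)), (∀ M, M ∈ S ↔ M ∈ decisionClass E ∧ (e ∈ M ↔ e ∉ Mstar)) →
      P.bordaGap Mstar e = (P.matchingReward Mstar : EReal) -
        S.sup (fun M => (P.matchingReward M : EReal)) →
      1 / (P.bordaGap Mstar e).toENNReal ^ 2 = 0 ∨
      ∃ M, IsBestDisagreeing P Mstar e M ∧ (P.bordaGap Mstar e).toENNReal =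
        ENNReal.ofReal (P.matchingReward Mstar - P.matchingReward M) := by
    intro S hS hgap
    rcases eq_empty_or_exists_sup_coe_eq S P.matchingReward with h | ⟨M, hM, hmax, hsup⟩
    · left
      rw [hgap, h, Finset.sup_empty, EReal.coe_sub_bot]
      simp
    · right
      refine ⟨M, ⟨((hS M).1 hM).1, ((hS M).1 hM).2,
        fun M' hM' he => hmax M' ((hS M').2 ⟨hM', he⟩)⟩, ?_⟩
      rw [hgap, hsup, ← EReal.coe_sub, EReal.real_coe_toENNReal]
  by_cases he : e ∈ Mstar
  · refine key (matchingsAvoiding e) (fun M => ?_) ?_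
    · simp [matchingsAvoiding, he]
    · simp [PreferenceMatrix.bordaGap, he]
  · refine key (matchingsThrough e) (fun M => ?_) ?_
    · simp [matchingsThrough, he]
    · simp [PreferenceMatrix.bordaGap, he]

/-- The chi-squared bound on the Kullback–Leibler divergence of two Bernoulli laws. -/
theorem bernoulli_kl_le {p q c : ℝ} (hp0 : 0 < p) (hp1 : p < 1) (hq0 : 0 < q) (hq1 : q < 1)
    (hc : 0 < c) (hcq : c ≤ q * (1 - q)) :
    p * Real.log (p / q) + (1 - p) * Real.log ((1 - p) / (1 - q)) ≤ (p - q) ^ 2 / c := by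
  have hp1' : 0 < 1 - p := by linarith
  have hq1' : 0 < 1 - q := by linarith
  have h1 := mul_le_mul_of_nonneg_left (Real.log_le_sub_one_of_pos (div_pos hp0 hq0)) hp0.le
  have h2 := mul_le_mul_of_nonneg_left (Real.log_le_sub_one_of_pos (div_pos hp1' hq1')) hp1'.le
  calc _ ≤ p * (p / q - 1) + (1 - p) * ((1 - p) / (1 - q) - 1) := add_le_add h1 h2
    _ = (p - q) ^ 2 / (q * (1 - q)) := by
      field_simp
      ring
    _ ≤ (p - q) ^ 2 / c := div_le_div_of_nonneg_left (sq_nonneg _) hc hcq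

/-- The potential that promotes the matching `M`, mainly through the edge `e`. -/
noncomputable def promote (e : Edge E) (M : Finset (Edge E)) (Δ η : ℝ) (f : Edge E) : ℝ :=
  (if f = e then (if e ∈ M then Δ else -Δ) else 0) + if f ∈ M then η else 0

theorem sum_promote (e : Edge E) (M : Finset (Edge E)) (Δ η : ℝ) (M' : Finset (Edge E)) :
    ∑ f ∈ M', promote e M Δ η f =
      (if e ∈ M' then (if e ∈ M then Δ else -Δ) else 0) + (M' ∩ M).card * η := by
  simp only [promote, Finset.sum_add_distrib, Finset.sum_ite_eq', Finset.sum_ite_mem,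
    Finset.sum_const, nsmul_eq_mul]

/-- The square of a difference of the potential at two edges. -/
theorem sq_promote_sub_le (e : Edge E) (M : Finset (Edge E)) (Δ η : ℝ) (f f' : Edge E) :
    (promote e M Δ η f - promote e M Δ η f') ^ 2 ≤
      2 * Δ ^ 2 * (if f = e ∨ f' = e then 1 else 0) + 2 * η ^ 2 := by
  have key : ∀ x y z : ℝ, x ^ 2 ≤ Δ ^ 2 * z → y ^ 2 ≤ η ^ 2 →
      (x + y) ^ 2 ≤ 2 * Δ ^ 2 * z + 2 * η ^ 2 := fun x y z hx hy => by
    nlinarith [sq_nonneg (x - y)]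
  have e1 : promote e M Δ η f - promote e M Δ η f' =
      ((if f = e then (if e ∈ M then Δ else -Δ) else 0) -
        (if f' = e then (if e ∈ M then Δ else -Δ) else 0)) +
      ((if f ∈ M then η else 0) - (if f' ∈ M then η else 0)) := by
    simp only [promote]
    ring
  rw [e1]
  apply key
  · by_cases hf : f = e <;> by_cases hf' : f' = e <;> by_cases he : e ∈ M <;>
      simp [hf, hf', he, sq_nonneg]
  · split_ifs <;> simp [sq_nonneg]

theorem abs_promote_sub_le (e : Edge E) (M : Finset (Edge E)) {Δ η : ℝ} (hΔ : 0 ≤ Δ) (hη : 0 ≤ η)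
    (f f' : Edge E) : |promote e M Δ η f - promote e M Δ η f'| ≤ Δ + η := by
  rw [abs_le]
  unfold promote
  constructor <;> split_ifs <;> linarith

/-- A rival that contains `e` exactly when `M` does gets the same shift from `e` and had at most the
reward of `M`. Any other rival had at most the reward of `Mstar`, and `M` gains the whole gap on it
through `e`. The `η` term breaks ties, since a rival shares fewer than `l` edges with `M`. -/
theorem isBordaWinner_perturb_promote {P : PreferenceMatrix E}
    (hl : ∃ M : Finset (Edge E), IsMatching M ∧ M.card = l) {Mstar M : Finset (Edge E)}
    (hstar : P.IsBordaWinner Mstar) {e : Edge E} (hM : IsBestDisagreeing P Mstar e M) {η : ℝ}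
    (hη : 0 < η)
    (h : ∀ f f' : Edge E, f.pos = f'.pos → 0 ≤ P.p f f' +
      (promote e M (P.matchingReward Mstar - P.matchingReward M) η f -
        promote e M (P.matchingReward Mstar - P.matchingReward M) η f')) :
    (P.perturb _ h).IsBordaWinner M := by
  have hl0 : 0 < l := e.pos.pos
  rw [PreferenceMatrix.isBordaWinner_iff _ hl0] at hstar ⊢
  obtain ⟨hMd, hMe, hmax⟩ := hM
  refine ⟨hMd, fun M' hM' hne => ?_⟩
  rw [P.matchingReward_perturb hl hM', P.matchingReward_perturb hl hMd, sum_promote, sum_promote]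
  have hcard : ((M' ∩ M).card : ℝ) * η < ((M ∩ M).card : ℝ) * η := by
    refine mul_lt_mul_of_pos_right ?_ hη
    rw [Finset.inter_self]
    have hlt : M' ∩ M ⊂ M := by
      refine Finset.inter_subset_right.ssubset_of_ne fun heq => hne ?_
      have hsub : M ⊆ M' := Finset.inter_eq_right.1 heq
      refine (Finset.eq_of_subset_of_card_le hsub ?_).symm
      rw [(isMatching_and_card_of_mem hl hM').2, (isMatching_and_card_of_mem hl hMd).2]
    exact_mod_cast Finset.card_lt_card hlt
  have hle : P.matchingReward M' ≤ P.matchingReward Mstar := by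
    by_cases hs : M' = Mstar
    · rw [hs]
    · exact (hstar.2 M' hM' hs).le
  by_cases he' : e ∈ M' ↔ e ∉ Mstar
  · have := hmax M' hM' he'
    have hiff : e ∈ M' ↔ e ∈ M := he'.trans hMe.symm
    simp only [hiff]
    linarith
  · by_cases hs : e ∈ Mstar
    · have h1 : e ∉ M := by simpa [hs] using hMe
      have h2 : e ∈ M' := by simpa [hs] using he'
      simp only [h1, h2, if_true, if_false]
      linarith
    · have h1 : e ∈ M := by simpa [hs] using hMe
      have h2 : e ∉ M' := by simpa [hs] using he'
      simp only [h1, h2, if_true, if_false]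
      linarith

end CPEDB

/-! ### The lower bound on the duels at a single edge. -/

namespace CPEDB

variable {n l : ℕ} {E : Finset (Fin n × Fin l)}

theorem IsBestDisagreeing.gap_pos {P : PreferenceMatrix E} {Mstar M : Finset (Edge E)}
    {e : Edge E} (hstar : P.IsBordaWinner Mstar) (hM : IsBestDisagreeing P Mstar e M) :
    0 < P.matchingReward Mstar - P.matchingReward M := by
  have hne : M ≠ Mstar := by
    rintro rfl
    exact iff_not_self hM.2.1
  have := ((P.isBordaWinner_iff e.pos.pos Mstar).1 hstar).2 M hM.1 hne
  linarith

/-- The ratio in `hratio` is at least 1, which gives `4γl ≤ 1 - 4γ`. Rewards of maximum matchings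
lie in an interval of length `2γl`, so the gap is at most `2γl ≤ 1/2 - 2γ`. -/
theorem IsBestDisagreeing.gap_le {γ : ℝ} (hγ0 : 0 < γ)
    (hl : ∃ M : Finset (Edge E), IsMatching M ∧ M.card = l)
    (hratio : ∀ e : Edge E, (matchingsThrough e).card ≠ (decisionClass E).card →
      ((decisionClass E).card : ℝ) / (((decisionClass E).card : ℝ) - ((matchingsThrough e).card : ℝ))
        ≤ (1 - 4 * γ) / (4 * γ * (l : ℝ)))
    {P : PreferenceMatrix E}
    (hp : ∀ e e' : Edge E, e.pos = e'.pos → 1 / 2 - γ ≤ P.p e e' ∧ P.p e e' ≤ 1 / 2 + γ)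
    {Mstar M : Finset (Edge E)} {e : Edge E} (hstar : Mstar ∈ decisionClass E)
    (hM : IsBestDisagreeing P Mstar e M) :
    P.matchingReward Mstar - P.matchingReward M ≤ 1 / 2 - 2 * γ := by
  have hl0 : (0 : ℝ) < l := by exact_mod_cast e.pos.pos
  -- `M` and `Mstar` disagree about `e`, so `e` does not lie in every maximum matching and `hratio`
  -- applies to it.
  have hlt : (matchingsThrough e).card < (decisionClass E).card := by
    refine Finset.card_lt_card ((Finset.filter_subset _ _).ssubset_of_ne fun heq => ?_)
    have hmem : ∀ M' ∈ decisionClass E, e ∈ M' := Finset.filter_eq_self.1 heq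
    exact hM.2.1.1 (hmem M hM.1) (hmem Mstar hstar)
  have hr := hratio e hlt.ne
  have hlt' : ((matchingsThrough e).card : ℝ) < (decisionClass E).card := by exact_mod_cast hlt
  have h1 : 1 ≤ ((decisionClass E).card : ℝ) /
      (((decisionClass E).card : ℝ) - ((matchingsThrough e).card : ℝ)) := by
    rw [le_div_iff₀ (by linarith)]
    have : (0 : ℝ) ≤ (matchingsThrough e).card := Nat.cast_nonneg _
    linarith
  have h2 := h1.trans hr
  rw [le_div_iff₀ (by positivity)] at h2
  have h3 := (P.matchingReward_bounds hl hp hstar).2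
  have h4 := (P.matchingReward_bounds hl hp hM.1).1
  linarith

/-- The number of duels of a history that involve the edge `e`. -/
noncomputable def duelCount (e : Edge E) (h : History E) : ℝ :=
  (h.map fun x => if x.1.1.1 = e ∨ x.1.1.2 = e then (1 : ℝ) else 0).sum

theorem sum_duelCount_le (h : History E) : ∑ e, duelCount e h ≤ 2 * h.length := by
  induction h with
  | nil => simp [duelCount]
  | cons x h ih =>
    have h1 : ∑ e : Edge E, (if x.1.1.1 = e ∨ x.1.1.2 = e then (1 : ℝ) else 0) ≤ 2 := by
      calc _ ≤ ∑ e : Edge E, ((if x.1.1.1 = e then (1 : ℝ) else 0) +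
            if x.1.1.2 = e then 1 else 0) := by
            refine Finset.sum_le_sum fun e _ => ?_
            by_cases h1 : x.1.1.1 = e <;> by_cases h2 : x.1.1.2 = e <;> simp [h1, h2]
        _ = 2 := by
            rw [Finset.sum_add_distrib]
            simp
            norm_num
    simp only [duelCount, List.map_cons, List.sum_cons, Finset.sum_add_distrib, List.length_cons,
      Nat.cast_add, Nat.cast_one] at ih ⊢
    linarith

theorem sum_map_const_mul_add (e : Edge E) (a b : ℝ) (h : History E) :
    (h.map fun x => a * (if x.1.1.1 = e ∨ x.1.1.2 = e then (1 : ℝ) else 0) + b).sum =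
      a * duelCount e h + b * h.length := by
  induction h with
  | nil => simp [duelCount]
  | cons x h ih =>
    rw [List.map_cons, List.sum_cons, ih]
    simp only [duelCount, List.map_cons, List.sum_cons, List.length_cons, Nat.cast_add,
      Nat.cast_one]
    ring

theorem outcomeProb_mem {P : PreferenceMatrix E} {r : ℝ}
    (hp : ∀ e e' : Edge E, e.pos = e'.pos → r ≤ P.p e e' ∧ P.p e e' ≤ 1 - r) (q : Duel E)
    (b : Bool) : r ≤ P.outcomeProb q b := by
  have := hp _ _ q.2
  cases b <;> simp only [PreferenceMatrix.outcomeProb, if_true, Bool.false_eq_true, if_false] <;>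
    linarith

theorem answer_mul_log_le_duelCount_add {γ : ℝ} (hγ0 : 0 < γ) (hγ1 : γ < 1 / 4)
    (hl : ∃ M : Finset (Edge E), IsMatching M ∧ M.card = l) {P : PreferenceMatrix E}
    (hp : ∀ e e' : Edge E, e.pos = e'.pos → 1 / 2 - γ ≤ P.p e e' ∧ P.p e e' ≤ 1 / 2 + γ)
    {Mstar M : Finset (Edge E)} {e : Edge E} (hstar : P.IsBordaWinner Mstar)
    (hM : IsBestDisagreeing P Mstar e M) {Δ : ℝ}
    (hΔ : Δ = P.matchingReward Mstar - P.matchingReward M) (hΔle : Δ ≤ 1 / 2 - 2 * γ)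
    {δ : ℝ} (hδ0 : 0 < δ) {A : Algorithm E} (hA : A.IsCorrect δ) (t : ℕ) {η : ℝ} (hη0 : 0 < η)
    (hη1 : η ≤ γ / 2) :
    ((A.run P t).map Prod.snd (some Mstar)).toReal * Real.log (1 / δ) - 1 ≤
      8 / γ * Δ ^ 2 * expect (A.run P t) (fun s => duelCount e s.1) +
        8 / γ * η ^ 2 * expect (A.run P t) fun s => (s.1.length : ℝ) := by
  have hΔ0 : 0 < Δ := hΔ ▸ hM.gap_pos hstar
  have hne : Mstar ≠ M := by
    rintro rfl
    exact iff_not_self hM.2.1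
  set a := promote e M Δ η with ha
  -- This is `Δ + η ≤ (1/2 - 2γ) + γ/2`, which leaves a margin of `γ/2` from 0 and 1 for the shifted
  -- probabilities.
  have habs : ∀ f f', |a f - a f'| ≤ 1 / 2 - 3 / 2 * γ := fun f f' =>
    (abs_promote_sub_le e M hΔ0.le hη0.le f f').trans (by linarith)
  have h : ∀ f f' : Edge E, f.pos = f'.pos → 0 ≤ P.p f f' + (a f - a f') := by
    intro f f' hpos
    have h1 := (abs_le.1 (habs f f')).1
    have h2 := (hp f f' hpos).1
    linarith
  have hwin : (P.perturb a h).IsBordaWinner M := by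
    subst hΔ
    exact isBordaWinner_perturb_promote hl hstar hM hη0 h
  have hQp : ∀ f f' : Edge E, f.pos = f'.pos →
      (P.perturb a h).p f f' = P.p f f' + (a f - a f') := fun f f' hpos => if_pos hpos
  have hQ : ∀ f f' : Edge E, f.pos = f'.pos →
      γ / 2 ≤ (P.perturb a h).p f f' ∧ (P.perturb a h).p f f' ≤ 1 - γ / 2 := by
    intro f f' hpos
    rw [hQp f f' hpos]
    have h1 := abs_le.1 (habs f f')
    have h2 := hp f f' hpos
    constructor <;> linarith [h1.1, h1.2, h2.1, h2.2]
  have hP0 : ∀ q b, 0 < P.outcomeProb q b := fun q b =>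
    lt_of_lt_of_le (by linarith : 0 < 1 / 2 - γ) (outcomeProb_mem (fun f f' hpos =>
      ⟨(hp f f' hpos).1, by linarith [(hp f f' hpos).2]⟩) q b)
  have hQ0 : ∀ q b, 0 < (P.perturb a h).outcomeProb q b := fun q b =>
    lt_of_lt_of_le (by linarith : 0 < γ / 2) (outcomeProb_mem hQ q b)
  have hbound := A.answer_mul_log_le hP0 hQ0 (κ := fun q => 8 / γ * Δ ^ 2 *
    (if q.1.1 = e ∨ q.1.2 = e then 1 else 0) + 8 / γ * η ^ 2) ?_ t Mstar hδ0
    (A.map_snd_run_le_of_answerProb _ hne (hA _ M hwin) t)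
  · refine hbound.trans_eq ?_
    simp_rw [sum_map_const_mul_add]
    rw [expect_add (A.support_run_finite P t), expect_const_mul, expect_const_mul]
  · intro q
    have hp' := hp _ _ q.2
    have hQ' := hQ _ _ q.2
    -- For `q` in `[γ/2, 1 - γ/2]`, `q(1 - q) ≥ (γ/2)(1 - γ/2) ≥ γ/4`.
    have hk := bernoulli_kl_le (p := P.p q.1.1 q.1.2) (q := (P.perturb a h).p q.1.1 q.1.2)
      (c := γ / 4) (by linarith) (by linarith) (by linarith) (by linarith) (by linarith)
      (by nlinarith [mul_nonneg (sub_nonneg.2 hQ'.1) (sub_nonneg.2 hQ'.2)])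
    simp only [PreferenceMatrix.outcomeProb, if_true, Bool.false_eq_true, if_false]
    refine hk.trans ?_
    have hsq := sq_promote_sub_le e M Δ η q.1.1 q.1.2
    rw [hQp _ _ q.2, div_le_iff₀ (by linarith)]
    have e1 : (P.p q.1.1 q.1.2 - (P.p q.1.1 q.1.2 + (a q.1.1 - a q.1.2))) ^ 2 =
      (a q.1.1 - a q.1.2) ^ 2 := by ring
    rw [e1]
    refine hsq.trans_eq ?_
    field_simp
    ring

/-- At a fixed `t` the expected length is a real number independent of `η`, so the tie-breaking cost
vanishes as `η → 0`. -/
theorem answer_mul_log_le_duelCount {γ : ℝ} (hγ0 : 0 < γ) (hγ1 : γ < 1 / 4)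
    (hl : ∃ M : Finset (Edge E), IsMatching M ∧ M.card = l) {P : PreferenceMatrix E}
    (hp : ∀ e e' : Edge E, e.pos = e'.pos → 1 / 2 - γ ≤ P.p e e' ∧ P.p e e' ≤ 1 / 2 + γ)
    {Mstar M : Finset (Edge E)} {e : Edge E} (hstar : P.IsBordaWinner Mstar)
    (hM : IsBestDisagreeing P Mstar e M) {Δ : ℝ}
    (hΔ : Δ = P.matchingReward Mstar - P.matchingReward M) (hΔle : Δ ≤ 1 / 2 - 2 * γ)
    {δ : ℝ} (hδ0 : 0 < δ) {A : Algorithm E} (hA : A.IsCorrect δ) (t : ℕ) :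
    ((A.run P t).map Prod.snd (some Mstar)).toReal * Real.log (1 / δ) - 1 ≤
      8 / γ * Δ ^ 2 * expect (A.run P t) (fun s => duelCount e s.1) := by
  set D := expect (A.run P t) (fun s => duelCount e s.1)
  set T := expect (A.run P t) fun s => (s.1.length : ℝ)
  have hlim : Filter.Tendsto (fun η : ℝ => 8 / γ * Δ ^ 2 * D + 8 / γ * η ^ 2 * T)
      (nhdsWithin 0 (Set.Ioi 0)) (nhds (8 / γ * Δ ^ 2 * D)) := by
    have hc : Continuous fun η : ℝ => 8 / γ * Δ ^ 2 * D + 8 / γ * η ^ 2 * T := by fun_prop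
    have := (hc.tendsto 0).mono_left (nhdsWithin_le_nhds (s := Set.Ioi 0))
    simpa using this
  refine ge_of_tendsto hlim ?_
  filter_upwards [Ioc_mem_nhdsGT (by linarith : (0 : ℝ) < γ / 2)] with η hη
  exact answer_mul_log_le_duelCount_add hγ0 hγ1 hl hp hstar hM hΔ hΔle hδ0 hA t hη.1 hη.2

theorem exists_time_answer_gt {P : PreferenceMatrix E} {Mstar : Finset (Edge E)}
    (hstar : P.IsBordaWinner Mstar) {δ : ℝ} (hδ0 : 0 < δ) (hδ1 : δ < 1 / 10)
    {A : Algorithm E} (hA : A.IsCorrect δ) :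
    ∃ t, 4 / 5 ≤ ((A.run P t).map Prod.snd (some Mstar)).toReal := by
  have h : ENNReal.ofReal (4 / 5) < A.answerProb P Mstar :=
    ((ENNReal.ofReal_lt_ofReal_iff (by linarith)).2 (by linarith)).trans_le (hA P Mstar hstar)
  obtain ⟨t, ht⟩ := lt_iSup_iff.1 h
  refine ⟨t, ?_⟩
  exact (ENNReal.ofReal_le_iff_le_toReal (PMF.apply_ne_top _ _)).1 ht.le

theorem two_lt_log_inv {δ : ℝ} (hδ0 : 0 < δ) (hδ1 : δ < 1 / 10) : 2 < Real.log (1 / δ) := by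
  rw [Real.lt_log_iff_exp_lt (by positivity)]
  have h1 : Real.exp 2 < 10 := by
    have : Real.exp 2 = Real.exp 1 ^ 2 := by
      rw [← Real.exp_nat_mul]
      norm_num
    rw [this]
    nlinarith [Real.exp_one_lt_d9, Real.exp_pos 1]
  refine h1.trans ?_
  rw [lt_div_iff₀ hδ0]
  linarith

end CPEDB

/-! ### Summation over the edges. -/

theorem theorem3 (γ : ℝ) (hγ0 : 0 < γ) (hγ1 : γ < 1 / 4) :
    ∃ c : ℝ, 0 < c ∧
      ∀ (n l : ℕ) (E : Finset (Fin n × Fin l)),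
        (∃ M : Finset (CPEDB.Edge E), CPEDB.IsMatching M ∧ M.card = l) →
        (∀ e : CPEDB.Edge E,
          (CPEDB.matchingsThrough e).card ≠ (CPEDB.decisionClass E).card →
          ((CPEDB.decisionClass E).card : ℝ) /
              (((CPEDB.decisionClass E).card : ℝ) - ((CPEDB.matchingsThrough e).card : ℝ)) ≤
            (1 - 4 * γ) / (4 * γ * (l : ℝ))) →
        ∀ (P : CPEDB.PreferenceMatrix E),
          (∀ e e' : CPEDB.Edge E, e.pos = e'.pos →
            1 / 2 - γ ≤ P.p e e' ∧ P.p e e' ≤ 1 / 2 + γ) →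
          ∀ Mstar : Finset (CPEDB.Edge E), P.IsBordaWinner Mstar →
          ∀ δ : ℝ, 0 < δ → δ < 1 / 10 →
          ∀ A : CPEDB.Algorithm E, CPEDB.Algorithm.IsCorrect A δ →
            ENNReal.ofReal (c * Real.log (1 / δ)) * P.bordaHardness Mstar ≤
              CPEDB.Algorithm.expectedSamples A P := by
  -- Here `64 = 8 · 4 · 2`: the divergence constant `8/γ`, the lower bound `L / 4` in `hb'`, and two
  -- edges per duel.
  refine ⟨γ / 64, by positivity, ?_⟩
  intro n l E hl hratio P hp Mstar hstar δ hδ0 hδ1 A hA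
  obtain ⟨t, ht⟩ := CPEDB.exists_time_answer_gt hstar hδ0 hδ1 hA
  have hlog := CPEDB.two_lt_log_inv hδ0 hδ1
  have hfin := A.support_run_finite P t
  set L := Real.log (1 / δ)
  set D : CPEDB.Edge E → ℝ := fun e => CPEDB.expect (A.run P t) fun s => CPEDB.duelCount e s.1
  have hcount0 : ∀ e (s : CPEDB.RunState E), 0 ≤ CPEDB.duelCount e s.1 := fun e s =>
    List.sum_nonneg fun x hx => by
      obtain ⟨y, _, rfl⟩ := List.mem_map.1 hx
      split_ifs <;> norm_num
  have hD0 : ∀ e, 0 ≤ D e := fun e =>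
    (CPEDB.expect_const (A.run P t) 0).ge.trans (CPEDB.expect_mono hfin (hcount0 e))
  have hedge : ∀ e, ENNReal.ofReal (γ / 64 * L) * (1 / (P.bordaGap Mstar e).toENNReal ^ 2) ≤
      ENNReal.ofReal (D e / 2) := by
    intro e
    rcases CPEDB.bordaGap_cases P Mstar e with h | ⟨M, hM, hgap⟩
    · simp [h]
    · have hΔ0 := hM.gap_pos hstar
      have hb := CPEDB.answer_mul_log_le_duelCount hγ0 hγ1 hl hp hstar hM rfl
        (hM.gap_le hγ0 hl hratio hp hstar.1) hδ0 hA t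
      rw [hgap]
      set Δ := P.matchingReward Mstar - P.matchingReward M
      rw [← ENNReal.ofReal_pow hΔ0.le, one_div, ← ENNReal.ofReal_inv_of_pos (by positivity),
        ← ENNReal.ofReal_mul (by positivity)]
      refine ENNReal.ofReal_le_ofReal ?_
      -- Uses `(4/5) L - 1 ≥ L / 4`, which holds since `L > 2`.
      have hb' : L / 4 ≤ 8 / γ * Δ ^ 2 * D e := le_trans (by nlinarith) hb
      rw [← div_eq_mul_inv, div_le_iff₀ (by positivity)]
      have := mul_le_mul_of_nonneg_left hb' (by positivity : 0 ≤ γ / 16)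
      have e1 : γ / 16 * (8 / γ * Δ ^ 2 * D e) = D e / 2 * Δ ^ 2 := by
        field_simp
        ring
      rw [e1] at this
      linarith
  calc ENNReal.ofReal (γ / 64 * L) * P.bordaHardness Mstar
      = ∑ e, ENNReal.ofReal (γ / 64 * L) * (1 / (P.bordaGap Mstar e).toENNReal ^ 2) := by
        rw [CPEDB.PreferenceMatrix.bordaHardness, Finset.mul_sum]
    _ ≤ ∑ e, ENNReal.ofReal (D e / 2) := Finset.sum_le_sum fun e _ => hedge e
    _ = ENNReal.ofReal (∑ e, D e / 2) :=
        (ENNReal.ofReal_sum_of_nonneg fun e _ => div_nonneg (hD0 e) zero_le_two).symm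
    _ ≤ ENNReal.ofReal (CPEDB.expect (A.run P t) fun s => (s.1.length : ℝ)) := by
        refine ENNReal.ofReal_le_ofReal ?_
        rw [← Finset.sum_div, div_le_iff₀ zero_lt_two, ← CPEDB.expect_finset_sum hfin, mul_comm,
          ← CPEDB.expect_const_mul]
        exact CPEDB.expect_mono hfin fun s => CPEDB.sum_duelCount_le s.1
    _ = ∑' s : CPEDB.RunState E, A.run P t s * (s.1.length : ℝ≥0∞) := by
        rw [CPEDB.ofReal_expect hfin fun s => Nat.cast_nonneg _]
        simp
    _ ≤ CPEDB.Algorithm.expectedSamples A P :=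
        le_iSup (fun t => ∑' s : CPEDB.RunState E, A.run P t s * (s.1.length : ℝ≥0∞)) t
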